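/- Let $n, N \ge 1$ be integers, let $\mathcal{X} \subset \mathbb{R}^n$ be a convex body (a convex compact set with non-empty interior), and let $c \in \mathbb{R}^n$. Set $f^* = \min_{x\in\mathcal{X}} c^{T}x$ and $h = \max_{x\in\mathcal{X}} c^{T}x - \min_{x\in\mathcal{X}} c^{T}x$. Let $x^{(1)},\dots,x^{(N)}$ be independent random points, each uniformly distributed on $\mathcal{X}$, and let $f_{[1]} = \min_{i=1,\dots,N} c^{T}x^{(i)}$ be the empirical minimum. Then $f_{[1]}-f^*$ is integrable and $$\frac{h}{nN+1} \;\le\; \mathbb{E}\bigl[f_{[1]}-f^*\bigr] \;\le\; \frac{h}{n}\,B\!\left(N+1,\frac1n\right) \;\le\; h\left(\frac{1}{N+1}\right)^{1/n},$$ where $B(a,b)=\int_0^1 t^{a-1}(1-t)^{b-1}\,dt=\Gamma(a)\Gamma(b)/\Gamma(a+b)$ is the Euler Beta function. -/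

import Mathlib

open MeasureTheory ProbabilityTheory

namespace ConvexSampling

/-- The minimum of the linear objective `x ↦ cᵀx` over the set `X`. -/
noncomputable def objMin {n : ℕ} (c : EuclideanSpace ℝ (Fin n))
    (X : Set (EuclideanSpace ℝ (Fin n))) : ℝ :=
  sInf ((fun x => inner ℝ c x) '' X)

/-- The maximum of the linear objective `x ↦ cᵀx` over the set `X`. -/
noncomputable def objMax {n : ℕ} (c : EuclideanSpace ℝ (Fin n))
    (X : Set (EuclideanSpace ℝ (Fin n))) : ℝ :=
  sSup ((fun x => inner ℝ c x) '' X)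

/-- The extent `h = max_X cᵀx - min_X cᵀx` of `X` in the direction `c`. -/
noncomputable def objWidth {n : ℕ} (c : EuclideanSpace ℝ (Fin n))
    (X : Set (EuclideanSpace ℝ (Fin n))) : ℝ :=
  objMax c X - objMin c X

/-- The empirical minimum `min_i cᵀx⁽ⁱ⁾` of the objective over `N ≥ 1` points. -/
noncomputable def empMin {n N : ℕ} [NeZero N] (c : EuclideanSpace ℝ (Fin n))
    (x : Fin N → EuclideanSpace ℝ (Fin n)) : ℝ :=
  Finset.univ.inf' Finset.univ_nonempty (fun i => inner ℝ c (x i))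

/-- On a convex body the infimum in `objMin` is an attained minimum. -/
theorem isLeast_objMin {n : ℕ} (c : EuclideanSpace ℝ (Fin n))
    (X : ConvexBody (EuclideanSpace ℝ (Fin n))) :
    IsLeast ((fun x => inner ℝ c x) '' (X : Set (EuclideanSpace ℝ (Fin n))))
      (objMin c (X : Set (EuclideanSpace ℝ (Fin n)))) :=
  (X.isCompact.image (by fun_prop)).isLeast_sInf (X.nonempty.image _)

/-- On a convex body the supremum in `objMax` is an attained maximum. -/
theorem isGreatest_objMax {n : ℕ} (c : EuclideanSpace ℝ (Fin n))
    (X : ConvexBody (EuclideanSpace ℝ (Fin n))) :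
    IsGreatest ((fun x => inner ℝ c x) '' (X : Set (EuclideanSpace ℝ (Fin n))))
      (objMax c (X : Set (EuclideanSpace ℝ (Fin n)))) :=
  (X.isCompact.image (by fun_prop)).isGreatest_sSup (X.nonempty.image _)

end ConvexSampling

open ConvexSampling

/-! ### Beta integrals and a Gautschi-type estimate -/

section BetaIntegral

/-! The gap between the empirical and true minimum lies in `[0, h]` almost surely, so its mean is
the integral of its tail over that interval; by independence the tail is a product of one-point
tails. Each one-point tail is squeezed by homotheties, which scale volume by `r ^ n` and keep a
convex body inside itself. Contracting towards a maximiser gives the lower bound `(1 - t/h)^n`,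
towards a minimiser the upper bound `1 - (t/h)^n`. Taking `N`-th powers and integrating yields
`h/(nN+1)` and the Beta value. The last inequality is purely analytic: induction on `N` with
Bernoulli's inequality. -/

/-- Integrate the derivative of `t * (1 - t ^ n) ^ (N + 1)`, which vanishes at both endpoints. -/
theorem intervalIntegral_one_sub_pow_pow_succ {n : ℕ} (hn : n ≠ 0) (N : ℕ) :
    ((n : ℝ) * (N + 1) + 1) * ∫ t in (0 : ℝ)..1, (1 - t ^ n) ^ (N + 1) =
      n * (N + 1) * ∫ t in (0 : ℝ)..1, (1 - t ^ n) ^ N := by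
  have hderiv : ∀ t ∈ Set.uIcc (0 : ℝ) 1, HasDerivAt (fun t : ℝ => t * (1 - t ^ n) ^ (N + 1))
      (((n : ℝ) * (N + 1) + 1) * (1 - t ^ n) ^ (N + 1) - n * (N + 1) * (1 - t ^ n) ^ N) t := by
    intro t _
    have h := (hasDerivAt_id t).mul ((((hasDerivAt_id t).pow n).const_sub 1).pow (N + 1))
    refine h.congr_deriv ?_
    obtain ⟨m, rfl⟩ := Nat.exists_eq_succ_of_ne_zero hn
    simp only [id, Pi.pow_apply, Nat.succ_eq_add_one, Nat.add_sub_cancel]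
    push_cast
    ring
  have h := intervalIntegral.integral_eq_sub_of_hasDerivAt hderiv
    (Continuous.intervalIntegrable (by fun_prop) _ _)
  rw [intervalIntegral.integral_sub (Continuous.intervalIntegrable (by fun_prop) _ _)
    (Continuous.intervalIntegrable (by fun_prop) _ _), intervalIntegral.integral_const_mul,
    intervalIntegral.integral_const_mul] at h
  simp at h
  linarith

theorem beta_succ_left {a b : ℝ} (ha : 0 < a) (hb : 0 < b) :
    (a + b) * beta (a + 1) b = a * beta a b := by
  have hab : a + b ≠ 0 := by positivity
  have hG : Real.Gamma (a + b) ≠ 0 := (Real.Gamma_pos_of_pos (by positivity)).ne'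
  rw [beta, beta, show a + 1 + b = a + b + 1 by ring, Real.Gamma_add_one ha.ne',
    Real.Gamma_add_one hab]
  field_simp

theorem beta_one_left {b : ℝ} (hb : 0 < b) : beta 1 b = 1 / b := by
  have hG : Real.Gamma b ≠ 0 := (Real.Gamma_pos_of_pos hb).ne'
  rw [beta, add_comm, Real.Gamma_add_one hb.ne', Real.Gamma_one]
  field_simp

/-- Both sides obey the same recursion in `N`, which replaces the substitution `u = t ^ n`, `beta`
being defined through Gamma. -/
theorem intervalIntegral_one_sub_pow_pow {n : ℕ} (hn : n ≠ 0) (N : ℕ) :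
    ∫ t in (0 : ℝ)..1, (1 - t ^ n) ^ N = 1 / n * beta ((N : ℝ) + 1) (1 / n) := by
  have hn' : (0 : ℝ) < n := by positivity
  induction N with
  | zero => simp [beta_one_left (inv_pos.2 hn'), hn'.ne']
  | succ N ih =>
    have h := intervalIntegral_one_sub_pow_pow_succ hn N
    have hb := beta_succ_left (a := (N : ℝ) + 1) (b := 1 / (n : ℝ)) (by positivity) (by positivity)
    have hne : (n : ℝ) * (N + 1) + 1 ≠ 0 := by positivity
    apply mul_left_cancel₀ hne
    rw [h, ih]
    push_cast
    calc (n : ℝ) * (N + 1) * (1 / n * beta ((N : ℝ) + 1) (1 / n))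
        = ((N : ℝ) + 1) * beta ((N : ℝ) + 1) (1 / n) := by field_simp
      _ = _ := by rw [← hb]; field_simp

/-- A Gautschi-type bound for the Beta function. -/
theorem mul_beta_natCast_add_one_le {b : ℝ} (hb : 0 < b) (hb1 : b ≤ 1) (N : ℕ) :
    b * beta ((N : ℝ) + 1) b ≤ (1 / ((N : ℝ) + 1)) ^ b := by
  induction N with
  | zero => simp [beta_one_left hb, hb.ne']
  | succ N ih =>
    have hN : (0 : ℝ) < (N : ℝ) + 1 := by positivity
    have hrec := beta_succ_left hN hb
    -- Bernoulli for an exponent at most 1 controls the ratio of consecutive right-hand sides.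
    have hbern : (1 + 1 / ((N : ℝ) + 1)) ^ b ≤ 1 + b * (1 / ((N : ℝ) + 1)) :=
      rpow_one_add_le_one_add_mul_self (by linarith [one_div_pos.2 hN]) hb.le hb1
    have hsplit : (1 / ((N : ℝ) + 1)) ^ b =
        (1 / ((N : ℝ) + 1 + 1)) ^ b * (1 + 1 / ((N : ℝ) + 1)) ^ b := by
      rw [← Real.mul_rpow (by positivity) (by positivity)]
      congr 1
      field_simp
    have hpos : (0 : ℝ) ≤ (1 / ((N : ℝ) + 1 + 1)) ^ b := by positivity
    have hab : (0 : ℝ) < (N : ℝ) + 1 + b := by positivity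
    push_cast
    refine le_of_mul_le_mul_left ?_ hab
    calc ((N : ℝ) + 1 + b) * (b * beta ((N : ℝ) + 1 + 1) b)
        = ((N : ℝ) + 1) * (b * beta ((N : ℝ) + 1) b) := by rw [mul_left_comm, hrec]; ring
      _ ≤ ((N : ℝ) + 1) * ((1 / ((N : ℝ) + 1 + 1)) ^ b * (1 + b * (1 / ((N : ℝ) + 1)))) := by
        refine mul_le_mul_of_nonneg_left (ih.trans ?_) hN.le
        rw [hsplit]
        exact mul_le_mul_of_nonneg_left hbern hpos
      _ = _ := by field_simp

theorem intervalIntegral_one_sub_pow (m : ℕ) :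
    ∫ t in (0 : ℝ)..1, (1 - t) ^ m = 1 / ((m : ℝ) + 1) := by
  rw [intervalIntegral.integral_comp_sub_left (fun t : ℝ => t ^ m) 1]
  simp

theorem setIntegral_Ioc_comp_div {h : ℝ} (hh : 0 < h) (f : ℝ → ℝ) :
    ∫ t in Set.Ioc 0 h, f (t / h) = h * ∫ t in (0 : ℝ)..1, f t := by
  rw [← intervalIntegral.integral_of_le hh.le, intervalIntegral.integral_comp_div f hh.ne']
  simp [hh.ne']

end BetaIntegral

/-! ### One-point tail bounds by homothety -/

section Tails

variable {n : ℕ} {Ω : Type*} [MeasurableSpace Ω] {P : Measure Ω}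

theorem volume_convexBody_ne_zero {X : ConvexBody (EuclideanSpace ℝ (Fin n))}
    (hX : (interior (X : Set (EuclideanSpace ℝ (Fin n)))).Nonempty) :
    volume (X : Set (EuclideanSpace ℝ (Fin n))) ≠ 0 :=
  (Measure.measure_pos_of_nonempty_interior _ hX).ne'

/-- A uniform point falls in a set containing a homothetic copy of the body of ratio `r`,
centred in the body, with probability at least `r ^ n`. -/
theorem pow_le_measureReal_preimage_of_homothety
    {X : ConvexBody (EuclideanSpace ℝ (Fin n))}
    (hX : (interior (X : Set (EuclideanSpace ℝ (Fin n)))).Nonempty)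
    {Y : Ω → EuclideanSpace ℝ (Fin n)}
    (hY : pdf.IsUniform Y (X : Set (EuclideanSpace ℝ (Fin n))) P volume)
    {A : Set (EuclideanSpace ℝ (Fin n))} (hA : MeasurableSet A)
    {z : EuclideanSpace ℝ (Fin n)} (hz : z ∈ X) {r : ℝ} (hr0 : 0 ≤ r) (hr1 : r ≤ 1)
    (hsub : ∀ y ∈ X, AffineMap.homothety z r y ∈ A) :
    r ^ n ≤ P.real (Y ⁻¹' A) := by
  have h0 := volume_convexBody_ne_zero hX
  have htop : volume (X : Set (EuclideanSpace ℝ (Fin n))) ≠ ⊤ := X.isCompact.measure_lt_top.ne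
  have himg : AffineMap.homothety z r '' (X : Set (EuclideanSpace ℝ (Fin n))) ⊆ ↑X ∩ A := by
    rintro _ ⟨y, hy, rfl⟩
    refine ⟨?_, hsub y hy⟩
    rw [AffineMap.homothety_eq_lineMap]
    exact X.convex.lineMap_mem hz hy ⟨hr0, hr1⟩
  have hvol := measure_mono (μ := volume) himg
  rw [Measure.addHaar_image_homothety, finrank_euclideanSpace_fin,
    abs_of_nonneg (pow_nonneg hr0 n)] at hvol
  have hle : ENNReal.ofReal (r ^ n) ≤ P (Y ⁻¹' A) := by
    rw [hY.measure_preimage h0 htop hA]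
    exact (ENNReal.le_div_iff_mul_le (Or.inl h0) (Or.inl htop)).2 hvol
  have := hY.isProbabilityMeasure h0 htop
  exact (ENNReal.ofReal_le_iff_le_toReal (measure_ne_top _ _)).1 hle

theorem inner_homothety (c z y : EuclideanSpace ℝ (Fin n)) (r : ℝ) :
    inner ℝ c (AffineMap.homothety z r y) = (1 - r) * inner ℝ c z + r * inner ℝ c y := by
  simp only [AffineMap.homothety_apply, vsub_eq_sub, vadd_eq_add, inner_add_right,
    inner_smul_right, inner_sub_right]
  ring

variable {X : ConvexBody (EuclideanSpace ℝ (Fin n))}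
  {Y : Ω → EuclideanSpace ℝ (Fin n)} {c : EuclideanSpace ℝ (Fin n)}

theorem objMin_le_inner {y : EuclideanSpace ℝ (Fin n)} (hy : y ∈ X) :
    objMin c X ≤ inner ℝ c y :=
  (isLeast_objMin c X).2 ⟨y, hy, rfl⟩

theorem inner_le_objMax {y : EuclideanSpace ℝ (Fin n)} (hy : y ∈ X) :
    inner ℝ c y ≤ objMax c X :=
  (isGreatest_objMax c X).2 ⟨y, hy, rfl⟩

/-- Contract towards a maximiser with ratio `1 - t/h`: the objective on the copy is at least `t`
above the minimum. -/
theorem pow_le_measureReal_le_inner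
    (hX : (interior (X : Set (EuclideanSpace ℝ (Fin n)))).Nonempty)
    (hY : pdf.IsUniform Y (X : Set (EuclideanSpace ℝ (Fin n))) P volume)
    {t : ℝ} (ht0 : 0 ≤ t) (hth : t ≤ objWidth c X) (hh : 0 < objWidth c X) :
    (1 - t / objWidth c X) ^ n ≤ P.real (Y ⁻¹' {y | t ≤ inner ℝ c y - objMin c X}) := by
  obtain ⟨z, hz, hzc⟩ := (isGreatest_objMax c X).1
  have h1 : t / objWidth c X ≤ 1 := (div_le_one hh).2 hth
  have h0 : 0 ≤ t / objWidth c X := by positivity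
  refine pow_le_measureReal_preimage_of_homothety hX hY
    (measurableSet_le measurable_const (by fun_prop)) hz (by linarith) (by linarith) ?_
  intro y hy
  have hmul : t / objWidth c X * (objMax c X - objMin c X) = t := div_mul_cancel₀ t hh.ne'
  have := mul_le_mul_of_nonneg_left (objMin_le_inner (c := c) hy) (sub_nonneg.2 h1)
  simp only at hzc
  simp only [Set.mem_ofPred_eq, inner_homothety, hzc]
  linarith

/-- Contract towards a minimiser with ratio `t/h`: the copy lies in the closed complement, hence the
strict inequality here. -/
theorem measureReal_lt_inner_le
    (hX : (interior (X : Set (EuclideanSpace ℝ (Fin n)))).Nonempty)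
    (hY : pdf.IsUniform Y (X : Set (EuclideanSpace ℝ (Fin n))) P volume)
    {t : ℝ} (ht0 : 0 ≤ t) (hth : t ≤ objWidth c X) (hh : 0 < objWidth c X) :
    P.real (Y ⁻¹' {y | t < inner ℝ c y - objMin c X}) ≤ 1 - (t / objWidth c X) ^ n := by
  obtain ⟨z, hz, hzc⟩ := (isLeast_objMin c X).1
  have hv0 := volume_convexBody_ne_zero hX
  have htop : volume (X : Set (EuclideanSpace ℝ (Fin n))) ≠ ⊤ := X.isCompact.measure_lt_top.ne
  have := hY.isProbabilityMeasure hv0 htop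
  have h1 : t / objWidth c X ≤ 1 := (div_le_one hh).2 hth
  have h0 : 0 ≤ t / objWidth c X := by positivity
  have hmeas : MeasurableSet {y : EuclideanSpace ℝ (Fin n) | t < inner ℝ c y - objMin c X} :=
    measurableSet_lt measurable_const (by fun_prop)
  have hle : (t / objWidth c X) ^ n ≤
      P.real (Y ⁻¹' {y | t < inner ℝ c y - objMin c X}ᶜ) := by
    refine pow_le_measureReal_preimage_of_homothety hX hY hmeas.compl hz h0 h1 ?_
    intro y hy
    have hmul : t / objWidth c X * (objMax c X - objMin c X) = t := div_mul_cancel₀ t hh.ne'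
    have := mul_le_mul_of_nonneg_left (inner_le_objMax (c := c) hy) h0
    simp only at hzc
    simp only [Set.mem_compl_iff, Set.mem_ofPred_eq, inner_homothety, hzc, not_lt]
    linarith
  rw [Set.preimage_compl, probReal_compl_eq_one_sub₀
    ((hY.aemeasurable hv0 htop).nullMeasurableSet_preimage hmeas)] at hle
  linarith

theorem ae_mem_of_isUniform
    (hX : (interior (X : Set (EuclideanSpace ℝ (Fin n)))).Nonempty)
    (hY : pdf.IsUniform Y (X : Set (EuclideanSpace ℝ (Fin n))) P volume) :
    ∀ᵐ ω ∂P, Y ω ∈ X := by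
  have h := hY.measure_preimage (volume_convexBody_ne_zero hX) X.isCompact.measure_lt_top.ne
    X.isCompact.measurableSet.compl
  rw [Set.inter_compl_self, measure_empty, ENNReal.zero_div] at h
  exact h

theorem measureReal_forall_mem {ι E : Type*} [Fintype ι] [MeasurableSpace E]
    {x : ι → Ω → E} (hindep : iIndepFun x P) {A : Set E} (hA : MeasurableSet A) :
    P.real {ω | ∀ i, x i ω ∈ A} = ∏ i, P.real (x i ⁻¹' A) := by
  have h := hindep.measure_inter_preimage_eq_mul Finset.univ (sets := fun _ => A) (fun _ _ => hA)
  have hset : {ω | ∀ i, x i ω ∈ A} = ⋂ i ∈ Finset.univ, x i ⁻¹' A := by ext; simp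
  rw [measureReal_def, hset, h, ENNReal.toReal_prod]
  rfl

theorem le_empMin_sub_iff {N : ℕ} [NeZero N] {a t : ℝ} (x : Fin N → EuclideanSpace ℝ (Fin n)) :
    t ≤ empMin c x - a ↔ ∀ i, x i ∈ {y | t ≤ inner ℝ c y - a} := by
  simp [empMin, le_sub_iff_add_le]

theorem lt_empMin_sub_iff {N : ℕ} [NeZero N] {a t : ℝ} (x : Fin N → EuclideanSpace ℝ (Fin n)) :
    t < empMin c x - a ↔ ∀ i, x i ∈ {y | t < inner ℝ c y - a} := by
  simp [empMin, lt_sub_iff_add_lt]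

end Tails

/-! ### Integrating the tails -/

section Expectation

variable {n N : ℕ} [NeZero N] {X : ConvexBody (EuclideanSpace ℝ (Fin n))}
  {c : EuclideanSpace ℝ (Fin n)} {Ω : Type*} [MeasurableSpace Ω] {P : Measure Ω}
  {x : Fin N → Ω → EuclideanSpace ℝ (Fin n)}

theorem measurable_empMin :
    Measurable (fun y : Fin N → EuclideanSpace ℝ (Fin n) => empMin c y) := by
  have h : (fun y : Fin N → EuclideanSpace ℝ (Fin n) => empMin c y) =
      Finset.univ.inf' Finset.univ_nonempty
        (fun i (y : Fin N → EuclideanSpace ℝ (Fin n)) => inner ℝ c (y i)) := by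
    ext y
    simp [empMin, Finset.inf'_apply]
  rw [h]
  exact Finset.inf'_induction _ _ (fun _ hf _ hg => hf.inf hg) fun i _ => by fun_prop

theorem ae_empMin_sub_mem_Icc
    (hX : (interior (X : Set (EuclideanSpace ℝ (Fin n)))).Nonempty)
    (hunif : ∀ i, pdf.IsUniform (x i) (X : Set (EuclideanSpace ℝ (Fin n))) P volume) :
    ∀ᵐ ω ∂P, empMin c (fun i => x i ω) - objMin c X ∈ Set.Icc 0 (objWidth c X) := by
  filter_upwards [ae_all_iff.2 fun i => ae_mem_of_isUniform hX (hunif i)] with ω hω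
  constructor
  · rw [le_empMin_sub_iff]
    exact fun i => sub_nonneg.2 (objMin_le_inner (hω i))
  · refine sub_le_sub_right ((Finset.inf'_le _ (Finset.mem_univ 0)).trans ?_) _
    exact inner_le_objMax (hω 0)

theorem integrable_empMin_sub [IsFiniteMeasure P]
    (hX : (interior (X : Set (EuclideanSpace ℝ (Fin n)))).Nonempty)
    (hunif : ∀ i, pdf.IsUniform (x i) (X : Set (EuclideanSpace ℝ (Fin n))) P volume) :
    Integrable (fun ω => empMin c (fun i => x i ω) - objMin c X) P := by
  have hmeas : AEMeasurable (fun ω i => x i ω) P := aemeasurable_pi_lambda _ fun i =>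
    (hunif i).aemeasurable (volume_convexBody_ne_zero hX) X.isCompact.measure_lt_top.ne
  exact Integrable.of_mem_Icc _ _
    ((measurable_empMin.comp_aemeasurable hmeas).sub_const _) (ae_empMin_sub_mem_Icc hX hunif)

variable [IsProbabilityMeasure P]

theorem integral_empMin_sub_eq_le
    (hX : (interior (X : Set (EuclideanSpace ℝ (Fin n)))).Nonempty)
    (hindep : iIndepFun x P)
    (hunif : ∀ i, pdf.IsUniform (x i) (X : Set (EuclideanSpace ℝ (Fin n))) P volume) :
    ∫ ω, (empMin c (fun i => x i ω) - objMin c X) ∂P = ∫ t in Set.Ioc 0 (objWidth c X),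
      ∏ i, P.real (x i ⁻¹' {y | t ≤ inner ℝ c y - objMin c X}) := by
  have hae := ae_empMin_sub_mem_Icc (c := c) hX hunif
  rw [(integrable_empMin_sub hX hunif).integral_eq_integral_Ioc_meas_le
    (hae.mono fun _ h => h.1) (hae.mono fun _ h => h.2)]
  refine integral_congr_ae (Filter.Eventually.of_forall fun t => ?_)
  simp only [le_empMin_sub_iff]
  exact measureReal_forall_mem hindep (measurableSet_le measurable_const (by fun_prop))

theorem integral_empMin_sub_eq_lt
    (hX : (interior (X : Set (EuclideanSpace ℝ (Fin n)))).Nonempty)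
    (hindep : iIndepFun x P)
    (hunif : ∀ i, pdf.IsUniform (x i) (X : Set (EuclideanSpace ℝ (Fin n))) P volume) :
    ∫ ω, (empMin c (fun i => x i ω) - objMin c X) ∂P = ∫ t in Set.Ioc 0 (objWidth c X),
      ∏ i, P.real (x i ⁻¹' {y | t < inner ℝ c y - objMin c X}) := by
  have hae := ae_empMin_sub_mem_Icc (c := c) hX hunif
  rw [(integrable_empMin_sub hX hunif).integral_eq_integral_Ioc_meas_le
    (hae.mono fun _ h => h.1) (hae.mono fun _ h => h.2)]
  refine integral_congr_ae ?_
  -- Strict and non-strict tails agree for almost every `t`.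
  filter_upwards [meas_le_ae_eq_meas_lt P (volume.restrict (Set.Ioc 0 (objWidth c X)))
    (fun ω => empMin c (fun i => x i ω) - objMin c X)] with t ht
  rw [measureReal_def, ht]
  simp only [lt_empMin_sub_iff]
  exact measureReal_forall_mem hindep (measurableSet_lt measurable_const (by fun_prop))

/-- Monotonicity makes the product of tails integrable without any continuity in `t`. -/
theorem integrableOn_Ioc_of_antitone_prod {ι : Type*} [Fintype ι] {f : ι → ℝ → ℝ}
    (hf : ∀ i, Antitone (f i)) (hf0 : ∀ i t, 0 ≤ f i t) (a b : ℝ) :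
    IntegrableOn (fun t => ∏ i, f i t) (Set.Ioc a b) := by
  have hanti : Antitone fun t => ∏ i, f i t := fun s t hst =>
    Finset.prod_le_prod (fun i _ => hf0 i t) fun i _ => hf i hst
  exact ((hanti.antitoneOn _).integrableOn_isCompact (isCompact_Icc (a := a) (b := b))).mono_set
    Set.Ioc_subset_Icc_self

theorem width_div_le_integral_empMin_sub
    (hX : (interior (X : Set (EuclideanSpace ℝ (Fin n)))).Nonempty)
    (hindep : iIndepFun x P)
    (hunif : ∀ i, pdf.IsUniform (x i) (X : Set (EuclideanSpace ℝ (Fin n))) P volume)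
    (hh : 0 < objWidth c X) :
    objWidth c X / ((n : ℝ) * N + 1) ≤ ∫ ω, (empMin c (fun i => x i ω) - objMin c X) ∂P := by
  have hint := setIntegral_Ioc_comp_div hh fun t => (1 - t) ^ (n * N)
  rw [intervalIntegral_one_sub_pow, mul_one_div, Nat.cast_mul] at hint
  rw [← hint, integral_empMin_sub_eq_le hX hindep hunif]
  refine setIntegral_mono_on ?_ ?_ measurableSet_Ioc ?_
  · exact (Continuous.integrableOn_Icc (by fun_prop)).mono_set Set.Ioc_subset_Icc_self
  · refine integrableOn_Ioc_of_antitone_prod (fun i s t hst => ?_)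
      (fun _ _ => measureReal_nonneg) _ _
    exact measureReal_mono fun ω hω => hst.trans hω
  · intro t ht
    rw [pow_mul]
    calc ((1 - t / objWidth c X) ^ n) ^ N = ∏ _i : Fin N, (1 - t / objWidth c X) ^ n := by simp
      _ ≤ _ := Finset.prod_le_prod
        (fun _ _ => pow_nonneg (sub_nonneg.2 ((div_le_one hh).2 ht.2)) _)
        fun i _ => pow_le_measureReal_le_inner hX (hunif i) ht.1.le ht.2 hh

theorem integral_empMin_sub_le [NeZero n]
    (hX : (interior (X : Set (EuclideanSpace ℝ (Fin n)))).Nonempty)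
    (hindep : iIndepFun x P)
    (hunif : ∀ i, pdf.IsUniform (x i) (X : Set (EuclideanSpace ℝ (Fin n))) P volume)
    (hh : 0 < objWidth c X) :
    ∫ ω, (empMin c (fun i => x i ω) - objMin c X) ∂P ≤
      objWidth c X / n * beta ((N : ℝ) + 1) (1 / n) := by
  have hint := setIntegral_Ioc_comp_div hh fun t => (1 - t ^ n) ^ N
  rw [intervalIntegral_one_sub_pow_pow (NeZero.ne n), ← mul_assoc, mul_one_div] at hint
  rw [← hint, integral_empMin_sub_eq_lt hX hindep hunif]
  refine setIntegral_mono_on ?_ ?_ measurableSet_Ioc ?_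
  · refine integrableOn_Ioc_of_antitone_prod (fun i s t hst => ?_)
      (fun _ _ => measureReal_nonneg) _ _
    exact measureReal_mono fun ω hω => hst.trans_lt hω
  · exact (Continuous.integrableOn_Icc (by fun_prop)).mono_set Set.Ioc_subset_Icc_self
  · intro t ht
    calc _ ≤ ∏ _i : Fin N, (1 - (t / objWidth c X) ^ n) := Finset.prod_le_prod
          (fun _ _ => measureReal_nonneg)
          fun i _ => measureReal_lt_inner_le hX (hunif i) ht.1.le ht.2 hh
      _ = _ := by simp

end Expectation

theorem theorem1 {n N : ℕ} [NeZero n] [NeZero N]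
    (X : ConvexBody (EuclideanSpace ℝ (Fin n)))
    (hX : (interior (X : Set (EuclideanSpace ℝ (Fin n)))).Nonempty)
    (c : EuclideanSpace ℝ (Fin n))
    {Ω : Type*} [MeasurableSpace Ω] (P : Measure Ω) [IsProbabilityMeasure P]
    (x : Fin N → Ω → EuclideanSpace ℝ (Fin n))
    (hindep : iIndepFun x P)
    (hunif : ∀ i, pdf.IsUniform (x i) (X : Set (EuclideanSpace ℝ (Fin n))) P volume) :
    Integrable (fun ω => ConvexSampling.empMin c (fun i => x i ω) - ConvexSampling.objMin c X) P ∧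
    ConvexSampling.objWidth c X / ((n : ℝ) * (N : ℝ) + 1)
      ≤ ∫ ω, (ConvexSampling.empMin c (fun i => x i ω) - ConvexSampling.objMin c X) ∂P ∧
    ∫ ω, (ConvexSampling.empMin c (fun i => x i ω) - ConvexSampling.objMin c X) ∂P
      ≤ ConvexSampling.objWidth c X / (n : ℝ)
          * ProbabilityTheory.beta ((N : ℝ) + 1) (1 / (n : ℝ)) ∧
    ConvexSampling.objWidth c X / (n : ℝ)
          * ProbabilityTheory.beta ((N : ℝ) + 1) (1 / (n : ℝ))
      ≤ ConvexSampling.objWidth c X * (1 / ((N : ℝ) + 1)) ^ (1 / (n : ℝ)) := by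
  have hn : (1 : ℝ) ≤ n := by exact_mod_cast NeZero.one_le
  have hh : 0 ≤ ConvexSampling.objWidth c X := by
    obtain ⟨y, hy⟩ := X.nonempty
    exact sub_nonneg.2 ((objMin_le_inner hy).trans (inner_le_objMax hy))
  refine ⟨integrable_empMin_sub hX hunif, ?_, ?_, ?_⟩
  -- The tail bounds divide by `h`; when `h = 0` the almost sure bounds suffice.
  · rcases hh.eq_or_lt with h0 | hpos
    · rw [← h0, zero_div]
      exact integral_nonneg_of_ae ((ae_empMin_sub_mem_Icc hX hunif).mono fun _ h => h.1)
    · exact width_div_le_integral_empMin_sub hX hindep hunif hpos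
  · rcases hh.eq_or_lt with h0 | hpos
    · rw [← h0, zero_div, zero_mul]
      refine integral_nonpos_of_ae ((ae_empMin_sub_mem_Icc (c := c) hX hunif).mono fun _ h => ?_)
      exact h.2.trans_eq h0.symm
    · exact integral_empMin_sub_le hX hindep hunif hpos
  · have hb := mul_beta_natCast_add_one_le (b := 1 / (n : ℝ)) (by positivity)
      ((div_le_one (by positivity)).2 hn) N
    calc _ = ConvexSampling.objWidth c X * (1 / (n : ℝ) * beta ((N : ℝ) + 1) (1 / n)) := by ring
      _ ≤ _ := mul_le_mul_of_nonneg_left hb hh
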